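/- Let $n \ge 1$ be an integer. Let $\mathcal{MV}_n$ be the category whose objects are the MV-algebras in the variety generated by the $(n+1)$-element Łukasiewicz chain $\{0, \tfrac1n, \dots, \tfrac{n-1}{n}, 1\}$ (with $x \oplus y = \min(1, x+y)$ and $x^* = 1-x$), and whose morphisms are the MV-algebra homomorphisms. Let $\mathrm{Stone}_n$ be the following category. Its objects are the pairs $(X, (o_i)_{i=1}^{n-1})$ where $X$ is a Stone space (compact, Hausdorff, totally disconnected) and $o_1, \dots, o_{n-1}$ are open subsets of $X$ such that $o_i = o_{n-i}$ for $1 \le i \le n-1$, and $o_h \cap o_{i-h} \subseteq o_i$ for $2 \le i \le n-1$ and $1 \le h \le i-1$. A morphism $(X, (o_i)) \to (X', (o'_i))$ is a continuous map $f : X \to X'$ with $f^{-1}[o'_i] \subseteq o_i$ for $1 \le i \le n-1$. Then $\mathcal{MV}_n$ and $\mathrm{Stone}_n$ are dual to each other, that is, the categories $\mathcal{MV}_n^{\mathrm{op}}$ and $\mathrm{Stone}_n$ are equivalent. -/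

import Mathlib

open CategoryTheory

universe u

namespace MVStone

/-- MV-algebras in the signature `(⊕, *, 0)`; here `x + y` is `x ⊕ y` and `xᶜ` is `x*`.
The unit is `0ᶜ`. The one-element algebra is allowed. -/
class MVAlgebra (A : Type u) extends AddCommMonoid A, Compl A where
  compl_compl' : ∀ x : A, xᶜᶜ = x
  add_one' : ∀ x : A, x + (0 : A)ᶜ = (0 : A)ᶜ
  luk' : ∀ x y : A, (xᶜ + y)ᶜ + y = (yᶜ + x)ᶜ + x

/-- Homomorphisms of MV-algebras. -/
@[ext]
structure MVHom (A B : Type u) [MVAlgebra A] [MVAlgebra B] extends A →+ B where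
  map_compl' : ∀ x : A, toFun xᶜ = (toFun x)ᶜ

/-- The carrier `{i / n | 0 ≤ i ≤ n}` of the finite Łukasiewicz chain with `n + 1` elements. -/
def LukChain (n : ℕ) : Type := {x : ℚ // ∃ i : ℕ, i ≤ n ∧ x = (i : ℚ) / n}

namespace LukChain

variable {n : ℕ}

theorem val_nonneg (x : LukChain n) : 0 ≤ x.1 := by
  obtain ⟨i, -, h⟩ := x.2
  rw [h]; positivity

theorem val_le_one (x : LukChain n) : x.1 ≤ 1 := by
  obtain ⟨i, hi, h⟩ := x.2
  rw [h]
  exact div_le_one_of_le₀ (by exact_mod_cast hi) (by positivity)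

/-- Truncated addition `x ⊕ y = min (1, x + y)`. -/
def oplus [NeZero n] (x y : LukChain n) : LukChain n :=
  ⟨min 1 (x.1 + y.1), by
    obtain ⟨i, hi, hx⟩ := x.2
    obtain ⟨j, hj, hy⟩ := y.2
    have hn : (0 : ℚ) < n := by exact_mod_cast Nat.pos_of_ne_zero (NeZero.ne n)
    refine ⟨min n (i + j), min_le_left _ _, ?_⟩
    rw [hx, hy, ← add_div, Nat.cast_min, ← min_div_div_right hn.le, div_self hn.ne',
      Nat.cast_add]⟩

/-- Negation `x* = 1 - x`. -/
def star [NeZero n] (x : LukChain n) : LukChain n :=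
  ⟨1 - x.1, by
    obtain ⟨i, hi, hx⟩ := x.2
    have hn : (n : ℚ) ≠ 0 := by exact_mod_cast NeZero.ne n
    refine ⟨n - i, Nat.sub_le _ _, ?_⟩
    rw [hx, Nat.cast_sub hi, sub_div, div_self hn]⟩

instance [NeZero n] : Zero (LukChain n) := ⟨⟨0, 0, Nat.zero_le _, by simp⟩⟩

instance [NeZero n] : Add (LukChain n) := ⟨oplus⟩

/-- The Łukasiewicz chain `{0, 1/n, …, 1}` as an MV-algebra (`n ≥ 1`). -/
instance [NeZero n] : MVAlgebra (LukChain n) where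
  compl := star
  add_assoc x y z := by
    refine Subtype.ext ?_
    change min 1 (min 1 (x.1 + y.1) + z.1) = min 1 (x.1 + min 1 (y.1 + z.1))
    have hx := val_nonneg x
    have hz := val_nonneg z
    grind
  zero_add x := by
    refine Subtype.ext ?_
    change min 1 (0 + x.1) = x.1
    simpa using val_le_one x
  add_zero x := by
    refine Subtype.ext ?_
    change min 1 (x.1 + 0) = x.1
    simpa using val_le_one x
  add_comm x y := by
    refine Subtype.ext ?_
    change min 1 (x.1 + y.1) = min 1 (y.1 + x.1)
    rw [add_comm]
  nsmul := nsmulRec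
  compl_compl' x := by
    refine Subtype.ext ?_
    change 1 - (1 - x.1) = x.1
    ring
  add_one' x := by
    refine Subtype.ext ?_
    change min 1 (x.1 + (1 - 0)) = 1 - 0
    have hx := val_nonneg x
    grind
  luk' x y := by
    refine Subtype.ext ?_
    change min 1 (1 - min 1 (1 - x.1 + y.1) + y.1) = min 1 (1 - min 1 (1 - y.1 + x.1) + x.1)
    have hx := val_le_one x
    have hy := val_le_one y
    grind

end LukChain

/-- Terms of the language of MV-algebras in countably many variables. -/
inductive MVTerm : Type
  | var : ℕ → MVTerm
  | zero : MVTerm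
  | compl : MVTerm → MVTerm
  | add : MVTerm → MVTerm → MVTerm

/-- The value of a term in an MV-algebra under an assignment of the variables. -/
def MVTerm.eval {A : Type u} [MVAlgebra A] (v : ℕ → A) : MVTerm → A
  | .var k => v k
  | .zero => 0
  | .compl t => (t.eval v)ᶜ
  | .add s t => s.eval v + t.eval v

/-- `A` satisfies the identity `s ≈ t`. -/
def Satisfies (A : Type u) [MVAlgebra A] (s t : MVTerm) : Prop :=
  ∀ v : ℕ → A, s.eval v = t.eval v

/-- The variety (equational class) generated by the chain with `n + 1` elements: `A` satisfies
every identity that the chain satisfies. -/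
def InVariety (n : ℕ) [NeZero n] (A : Type u) [MVAlgebra A] : Prop :=
  ∀ s t : MVTerm, Satisfies (LukChain n) s t → Satisfies A s t

/-- Bundled MV-algebras. -/
structure MVAlg : Type (u + 1) where
  carrier : Type u
  [str : MVAlgebra carrier]

attribute [instance] MVAlg.str

/-- The category of MV-algebras and their homomorphisms. -/
instance : Category MVAlg.{u} where
  Hom A B := MVHom A.carrier B.carrier
  id A := { AddMonoidHom.id A.carrier with map_compl' := fun _ => rfl }
  comp f g := { g.toAddMonoidHom.comp f.toAddMonoidHom with
    map_compl' := fun x => (congrArg g.toFun (f.map_compl' x)).trans (g.map_compl' _) }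

/-- The category of MV-algebras in the variety generated by the chain `{0, 1/n, …, 1}`, as a full
subcategory of the category of MV-algebras. -/
abbrev MVn (n : ℕ) [NeZero n] : Type (u + 1) :=
  ObjectProperty.FullSubcategory (fun A : MVAlg.{u} => InVariety n A.carrier)

/-- The indices `1, …, n - 1`. -/
abbrev Idx (n : ℕ) : Type := {i : ℕ // 1 ≤ i ∧ i ≤ n - 1}

/-- Topological spaces with `n - 1` distinguished open sets `o 1, …, o (n - 1)` such that
`o i = o (n - i)` and `o h ∩ o (i - h) ⊆ o i` for `1 ≤ h ≤ i - 1`. -/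
structure TopN (n : ℕ) : Type (u + 1) where
  carrier : Type u
  [top : TopologicalSpace carrier]
  o : Idx n → Set carrier
  isOpen_o : ∀ i, IsOpen (o i)
  symm_o : ∀ i j : Idx n, (i : ℕ) + j = n → o i = o j
  inter_o : ∀ h k i : Idx n, (h : ℕ) + k = i → o h ∩ o k ⊆ o i

attribute [instance] TopN.top

/-- Continuous maps such that the preimage of the `i`-th distinguished open set of the target is
contained in the `i`-th distinguished open set of the source. -/
@[ext]
structure TopN.Hom {n : ℕ} (X Y : TopN.{u} n) where
  map : C(X.carrier, Y.carrier)
  preimage_subset : ∀ i, map ⁻¹' Y.o i ⊆ X.o i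

instance (n : ℕ) : Category (TopN.{u} n) where
  Hom X Y := TopN.Hom X Y
  id X := ⟨ContinuousMap.id _, fun _ => subset_rfl⟩
  comp f g := ⟨g.map.comp f.map, fun i _ hx => f.preimage_subset i (g.preimage_subset i hx)⟩

/-- Stone spaces (compact, Hausdorff, totally disconnected) with `n - 1` distinguished open sets,
as a full subcategory of `TopN n`. -/
abbrev StoneN (n : ℕ) : Type (u + 1) :=
  ObjectProperty.FullSubcategory (fun X : TopN.{u} n =>
    CompactSpace X.carrier ∧ T2Space X.carrier ∧ TotallyDisconnectedSpace X.carrier)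

end MVStone

-- A space `X` is sent to the algebra `Fun X` of continuous functions to the chain that take the
-- value `i / n` only on `o i`. The axioms on the `o i` say exactly that the values allowed at a
-- point form a subalgebra of the chain. Composition makes this a contravariant functor, which is
-- shown to be fully faithful and essentially surjective.
--
-- In the other direction, an algebra `A` in the variety is recovered from its homomorphisms to the
-- chain. They form a closed subset of a compact product, and `o i` collects those that attain `i /
-- n`. Evaluation is injective by `InVariety.exists_isMVHom`: any finite part of the conditions on a
-- separating homomorphism is solvable, since otherwise the chain would satisfy an identity that
-- fails in `A`; compactness then gives the whole homomorphism, with no theory of ideals. Evaluation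
-- is surjective by `exists_eq_apply`: Boolean elements separate homomorphisms
-- (`exists_isBool_separating`), so local representatives of a continuous function can be glued.
--
-- The same separation and compactness show that every homomorphism from `Fun X` to the chain is
-- evaluation at a point (`exists_eq_eval`), which gives fullness. Faithfulness holds because
-- indicators of clopen sets separate points.

universe v

namespace MVStone

/-! ### Arithmetic of MV-algebras and terms -/

section Algebra

variable {A : Type u} [MVAlgebra A]

theorem one_compl : ((0 : A)ᶜ)ᶜ = 0 := MVAlgebra.compl_compl' 0

theorem compl_add_self (x : A) : xᶜ + x = (0 : A)ᶜ := by
  have h := MVAlgebra.luk' x (0 : A)ᶜ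
  rw [MVAlgebra.add_one', one_compl, zero_add] at h
  exact h.symm

theorem eq_zero_of_add_eq_zero {x y : A} (h : x + y = 0) : x = 0 := by
  have h1 : xᶜ + (x + y) = (0 : A)ᶜ := by
    rw [← add_assoc, compl_add_self, add_comm, MVAlgebra.add_one']
  rw [h, add_zero] at h1
  rw [← MVAlgebra.compl_compl' x, h1, one_compl]

/-- The Chang distance. -/
def dist (x y : A) : A := (xᶜ + y)ᶜ + (yᶜ + x)ᶜ

/-- If the sum vanishes then so do both summands, and the Łukasiewicz axiom collapses to `y = x`.
This lets equations be encoded as vanishing terms. -/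
theorem dist_eq_zero {x y : A} : dist x y = 0 ↔ x = y := by
  constructor
  · intro h
    have h1 := eq_zero_of_add_eq_zero h
    have h2 := eq_zero_of_add_eq_zero ((add_comm _ _).trans h)
    have h3 := MVAlgebra.luk' x y
    rw [h1, h2, zero_add, zero_add] at h3
    exact h3.symm
  · rintro rfl
    rw [dist, compl_add_self, one_compl, zero_add]

end Algebra

/-- Homomorphisms between MV-algebras in possibly different universes, as a predicate. -/
structure IsMVHom {A : Type u} {B : Type v} [MVAlgebra A] [MVAlgebra B] (h : A → B) : Prop where
  map_zero : h 0 = 0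
  map_compl : ∀ x, h xᶜ = (h x)ᶜ
  map_add : ∀ x y, h (x + y) = h x + h y

theorem IsMVHom.map_eval {A : Type u} {B : Type v} [MVAlgebra A] [MVAlgebra B] {h : A → B}
    (hh : IsMVHom h) (w : ℕ → A) (t : MVTerm) : h (t.eval w) = t.eval (fun k => h (w k)) := by
  induction t with
  | var k => rfl
  | zero => exact hh.map_zero
  | compl t ih => simp only [MVTerm.eval, hh.map_compl, ih]
  | add s t ihs iht => simp only [MVTerm.eval, hh.map_add, ihs, iht]

namespace MVTerm

/-- The term computing the Chang distance of two terms. -/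
def dist (s t : MVTerm) : MVTerm :=
  .add (.compl (.add (.compl s) t)) (.compl (.add (.compl t) s))

/-- The `k`-fold sum of a term. -/
def smul (t : MVTerm) : ℕ → MVTerm
  | 0 => .zero
  | k + 1 => .add (t.smul k) t

/-- The sum of a list of terms. -/
def sum : List MVTerm → MVTerm
  | [] => .zero
  | t :: l => .add t (sum l)

variable {A : Type u} [MVAlgebra A] (w : ℕ → A)

theorem eval_dist (s t : MVTerm) : (s.dist t).eval w = MVStone.dist (s.eval w) (t.eval w) := rfl

theorem eval_smul (t : MVTerm) (k : ℕ) : (t.smul k).eval w = k • t.eval w := by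
  induction k with
  | zero => simp [smul, eval]
  | succ k ih => simp [smul, eval, ih, succ_nsmul]

theorem eval_sum (l : List MVTerm) : (sum l).eval w = (l.map (eval w)).sum := by
  induction l with
  | nil => simp [sum, eval]
  | cons t l ih => simp [sum, eval, ih]

end MVTerm

/-! ### The finite chain -/

namespace LukChain

variable {n : ℕ} [NeZero n]

theorem val_zero : (0 : LukChain n).1 = 0 := rfl
theorem val_compl (x : LukChain n) : xᶜ.1 = 1 - x.1 := rfl
theorem val_add (x y : LukChain n) : (x + y).1 = min 1 (x.1 + y.1) := rfl

theorem val_nsmul (x : LukChain n) (k : ℕ) : (k • x).1 = min 1 (k * x.1) := by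
  induction k with
  | zero => simp [val_zero]
  | succ k ih =>
    rw [succ_nsmul, val_add, ih]
    have := val_nonneg x
    push_cast
    grind

theorem cast_pos : (0 : ℚ) < n := by exact_mod_cast Nat.pos_of_ne_zero (NeZero.ne n)

theorem one_le_mul_val {x : LukChain n} (hx : x ≠ 0) : 1 ≤ n * x.1 := by
  obtain ⟨i, hi, h⟩ := x.2
  have hn := cast_pos (n := n)
  have hi0 : i ≠ 0 := by
    rintro rfl
    exact hx (Subtype.ext (by rw [h, val_zero]; simp))
  rw [h, mul_div_cancel₀ _ hn.ne']
  exact_mod_cast Nat.one_le_iff_ne_zero.2 hi0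

/-- A nonzero element is at least `1 / n`. Hence multiplication by `n` turns any element into the
Boolean test for being nonzero. -/
theorem nsmul_eq_one {x : LukChain n} (hx : x ≠ 0) : n • x = 0ᶜ := by
  refine Subtype.ext ?_
  rw [val_nsmul, val_compl, val_zero, sub_zero]
  exact min_eq_left (one_le_mul_val hx)

theorem one_add (x : LukChain n) : (0 : LukChain n)ᶜ + x = 0ᶜ := by
  rw [add_comm, MVAlgebra.add_one']

theorem one_ne_zero : (0 : LukChain n)ᶜ ≠ 0 := fun h => by
  have := congrArg Subtype.val h
  rw [val_compl, val_zero] at this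
  norm_num at this

instance : Finite (LukChain n) := by
  have : Function.Surjective (fun i : Fin (n + 1) =>
      (⟨(i : ℕ) / n, i, Nat.lt_succ_iff.1 i.2, rfl⟩ : LukChain n)) := by
    rintro ⟨x, i, hi, rfl⟩
    exact ⟨⟨i, Nat.lt_succ_iff.2 hi⟩, rfl⟩
  exact Finite.of_surjective _ this

instance : TopologicalSpace (LukChain n) := ⊥

instance : DiscreteTopology (LukChain n) := ⟨rfl⟩

end LukChain

/-- A list of elements of the chain that contains `1` sums to `1`. -/
theorem LukChain.sum_eq_one {n : ℕ} [NeZero n] {l : List (LukChain n)} (h : 0ᶜ ∈ l) :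
    l.sum = 0ᶜ := by
  induction l with
  | nil => simp at h
  | cons a l ih =>
    rw [List.sum_cons]
    rcases List.mem_cons.1 h with h | h
    · rw [← h, one_add]
    · rw [ih h, MVAlgebra.add_one']

/-! ### Separation by homomorphisms and by Boolean elements -/

section Separation

variable {A : Type u} [MVAlgebra A] {n : ℕ} [NeZero n]

/-- A finite set of term equations that hold in `A` under `w` has a solution in the chain that
separates two given variables with distinct values in `A`. -/
theorem InVariety.exists_solution (hA : InVariety n A) (w : ℕ → A) (l : List (MVTerm × MVTerm))
    (hl : ∀ p ∈ l, p.1.eval w = p.2.eval w) {i j : ℕ} (hij : w i ≠ w j) :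
    ∃ q : ℕ → LukChain n, q i ≠ q j ∧ ∀ p ∈ l, p.1.eval q = p.2.eval q := by
  by_contra! hcon
  set e : MVTerm := MVTerm.sum (l.map fun p => (p.1.dist p.2).smul n) with he
  set d : MVTerm := (MVTerm.var i).dist (.var j) with hd
  -- In the chain `e` is `1` as soon as one equation of `l` fails, and by `hcon` one fails whenever
  -- `d` is nonzero. In `A`, under `w`, `e` is `0`, so this identity forces `d` to vanish there.
  have key : Satisfies (LukChain n) (.add d e) e := by
    intro q
    change d.eval q + e.eval q = e.eval q
    by_cases hq : q i = q j
    · rw [hd, MVTerm.eval_dist, dist_eq_zero.2 (show MVTerm.eval q (.var i) = MVTerm.eval q (.var j) from hq), zero_add]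
    · obtain ⟨p, hp, hne⟩ := hcon q hq
      have : e.eval q = 0ᶜ := by
        rw [he, MVTerm.eval_sum]
        apply LukChain.sum_eq_one
        rw [List.map_map, List.mem_map]
        refine ⟨p, hp, ?_⟩
        rw [Function.comp, MVTerm.eval_smul, MVTerm.eval_dist]
        exact LukChain.nsmul_eq_one (fun h => hne (dist_eq_zero.1 h))
      rw [this, MVAlgebra.add_one']
  have he0 : e.eval w = 0 := by
    rw [he, MVTerm.eval_sum]
    apply List.sum_eq_zero
    intro x hx
    rw [List.map_map, List.mem_map] at hx
    obtain ⟨p, hp, rfl⟩ := hx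
    rw [Function.comp, MVTerm.eval_smul, MVTerm.eval_dist, dist_eq_zero.2 (hl p hp), nsmul_zero]
  have h := hA _ _ key w
  change d.eval w + e.eval w = e.eval w at h
  rw [he0, add_zero, hd, MVTerm.eval_dist, dist_eq_zero] at h
  exact hij h

/-- Naming the elements of `F`, `a` and `b` by variables turns the operation tables restricted to
`F` into finitely many equations that hold in `A`. -/
theorem InVariety.exists_partial_point (hA : InVariety n A) {a b : A} (hab : a ≠ b)
    (F : Finset A) : ∃ p : A → LukChain n, p a ≠ p b ∧ (0 ∈ F → p 0 = 0) ∧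
      (∀ x ∈ F, xᶜ ∈ F → p xᶜ = (p x)ᶜ) ∧
      (∀ x ∈ F, ∀ y ∈ F, x + y ∈ F → p (x + y) = p x + p y) := by
  classical
  set F' : Finset A := insert a (insert b F)
  obtain ⟨σ, w, hw⟩ : ∃ (σ : A → ℕ) (w : ℕ → A), ∀ x ∈ F', w (σ x) = x := by
    refine ⟨fun x => F'.toList.idxOf x, fun k => F'.toList.getD k 0, fun x hx => ?_⟩
    have hx' : F'.toList.idxOf x < F'.toList.length :=
      List.idxOf_lt_length_iff.2 (Finset.mem_toList.2 hx)
    simp only [List.getD_eq_getElem _ _ hx', List.getElem_idxOf]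
  have hF : ∀ x ∈ F, w (σ x) = x := fun x hx =>
    hw x (Finset.mem_insert_of_mem (Finset.mem_insert_of_mem hx))
  have ha : w (σ a) = a := hw a (Finset.mem_insert_self _ _)
  have hb : w (σ b) = b := hw b (Finset.mem_insert_of_mem (Finset.mem_insert_self _ _))
  set l0 : Finset (MVTerm × MVTerm) := (F.filter (· = 0)).image fun x => (.var (σ x), .zero)
  set l1 : Finset (MVTerm × MVTerm) :=
    (F.filter (fun x => xᶜ ∈ F)).image fun x => (.var (σ xᶜ), .compl (.var (σ x)))
  set l2 : Finset (MVTerm × MVTerm) := ((F ×ˢ F).filter (fun x => x.1 + x.2 ∈ F)).image fun x =>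
    (.var (σ (x.1 + x.2)), .add (.var (σ x.1)) (.var (σ x.2)))
  obtain ⟨q, hq, hql⟩ := hA.exists_solution w (l0 ∪ l1 ∪ l2).toList (by
    intro p hp
    simp only [Finset.mem_toList, Finset.mem_union] at hp
    rcases hp with (hp | hp) | hp
    · obtain ⟨x, hx, rfl⟩ := Finset.mem_image.1 hp
      obtain ⟨hx, rfl⟩ := Finset.mem_filter.1 hx
      exact hF _ hx
    · obtain ⟨x, hx, rfl⟩ := Finset.mem_image.1 hp
      obtain ⟨hx, hx'⟩ := Finset.mem_filter.1 hx
      simp only [MVTerm.eval, hF _ hx, hF _ hx']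
    · obtain ⟨x, hx, rfl⟩ := Finset.mem_image.1 hp
      obtain ⟨hx, hx'⟩ := Finset.mem_filter.1 hx
      obtain ⟨h1, h2⟩ := Finset.mem_product.1 hx
      simp only [MVTerm.eval, hF _ h1, hF _ h2, hF _ hx'])
    (i := σ a) (j := σ b) (by rwa [ha, hb])
  simp only [Finset.mem_toList, Finset.mem_union] at hql
  refine ⟨fun x => q (σ x), hq, fun h => ?_, fun x hx hx' => ?_, fun x hx y hy hxy => ?_⟩
  · exact hql (_, _) (.inl (.inl (Finset.mem_image.2 ⟨0, Finset.mem_filter.2 ⟨h, rfl⟩, rfl⟩)))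
  · exact hql (_, _) (.inl (.inr (Finset.mem_image.2 ⟨x, Finset.mem_filter.2 ⟨hx, hx'⟩, rfl⟩)))
  · exact hql (_, _) (.inr (Finset.mem_image.2
      ⟨(x, y), Finset.mem_filter.2 ⟨Finset.mk_mem_product hx hy, hxy⟩, rfl⟩))

/-- Homomorphisms to the chain separate the points of an algebra in the variety. -/
theorem InVariety.exists_isMVHom (hA : InVariety n A) {a b : A} (hab : a ≠ b) :
    ∃ p : A → LukChain n, IsMVHom p ∧ p a ≠ p b := by
  classical
  let K : Finset A → Set (A → LukChain n) := fun F =>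
    {p | p a ≠ p b ∧ (0 ∈ F → p 0 = 0) ∧ (∀ x ∈ F, xᶜ ∈ F → p xᶜ = (p x)ᶜ) ∧
      (∀ x ∈ F, ∀ y ∈ F, x + y ∈ F → p (x + y) = p x + p y)}
  have hclosed : ∀ F, IsClosed (K F) := by
    intro F
    have c2 : ∀ (x y : A) (R : LukChain n → LukChain n → Prop),
        IsClosed {p : A → LukChain n | R (p x) (p y)} := fun x y R =>
      (isClosed_discrete {z : LukChain n × LukChain n | R z.1 z.2}).preimage
        (f := fun p : A → LukChain n => (p x, p y)) (by fun_prop)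
    have c3 : ∀ (x y z : A) (R : LukChain n → LukChain n → LukChain n → Prop),
        IsClosed {p : A → LukChain n | R (p x) (p y) (p z)} := fun x y z R =>
      (isClosed_discrete {z : LukChain n × LukChain n × LukChain n | R z.1 z.2.1 z.2.2}).preimage
        (f := fun p : A → LukChain n => (p x, p y, p z)) (by fun_prop)
    simp only [K, Set.ofPred_and, Set.ofPred_forall]
    refine (c2 a b (· ≠ ·)).inter (.inter ?_ (.inter ?_ ?_))
    · exact isClosed_iInter fun _ => c2 0 0 (fun x _ => x = 0)
    · exact isClosed_iInter fun x => isClosed_iInter fun _ => isClosed_iInter fun _ =>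
        c2 xᶜ x (fun u v => u = vᶜ)
    · exact isClosed_iInter fun x => isClosed_iInter fun _ => isClosed_iInter fun y =>
        isClosed_iInter fun _ => isClosed_iInter fun _ => c3 (x + y) x y (fun u v w => u = v + w)
  have hanti : Antitone K := fun F G hFG p ⟨h1, h2, h3, h4⟩ =>
    ⟨h1, fun h => h2 (hFG h), fun x hx hx' => h3 x (hFG hx) (hFG hx'),
      fun x hx y hy hxy => h4 x (hFG hx) y (hFG hy) (hFG hxy)⟩
  -- The product of finite discrete chains is compact. A point common to all `K F` is a
  -- homomorphism, since each instance of an axiom involves at most three elements.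
  obtain ⟨p, hp⟩ := IsCompact.nonempty_iInter_of_directed_nonempty_isCompact_isClosed K
    hanti.directed_ge (fun F => hA.exists_partial_point hab F)
    (fun F => (hclosed F).isCompact) hclosed
  rw [Set.mem_iInter] at hp
  refine ⟨p, ⟨?_, fun x => ?_, fun x y => ?_⟩, (hp ∅).1⟩
  · exact (hp {0}).2.1 (by simp)
  · exact (hp {x, xᶜ}).2.2.1 x (by simp) (by simp)
  · exact (hp {x, y, x + y}).2.2.2 x (by simp) y (by simp) (by simp)

/-- An algebra whose points are separated by homomorphisms to the chain is in the variety. -/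
theorem inVariety_of_separated
    (h : ∀ a b : A, (∀ p : A → LukChain n, IsMVHom p → p a = p b) → a = b) : InVariety n A := by
  intro s t hst w
  refine h _ _ fun p hp => ?_
  rw [hp.map_eval, hp.map_eval]
  exact hst _

/-- The truncated product. -/
def odot (x y : A) : A := (xᶜ + yᶜ)ᶜ

theorem IsMVHom.map_odot {p : A → LukChain n} (hp : IsMVHom p) (x y : A) :
    (p (odot x y)).1 = max 0 ((p x).1 + (p y).1 - 1) := by
  rw [odot, hp.map_compl, hp.map_add, hp.map_compl, hp.map_compl, LukChain.val_compl,
    LukChain.val_add, LukChain.val_compl, LukChain.val_compl]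
  grind

theorem IsMVHom.val_add {p : A → LukChain n} (hp : IsMVHom p) (x y : A) :
    (p (x + y)).1 = min 1 ((p x).1 + (p y).1) := by
  rw [hp.map_add, LukChain.val_add]

theorem IsMVHom.val_compl {p : A → LukChain n} (hp : IsMVHom p) (x : A) :
    (p xᶜ).1 = 1 - (p x).1 := by
  rw [hp.map_compl, LukChain.val_compl]

theorem IsMVHom.map_nsmul {p : A → LukChain n} (hp : IsMVHom p) (k : ℕ) (x : A) :
    p (k • x) = k • p x := by
  induction k with
  | zero => simp [hp.map_zero]
  | succ k ih => simp [succ_nsmul, hp.map_add, ih]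

/-- If both values lie on the same side of `1 / 2`, then `a + a` or `odot a a` doubles the gap. If
`1 / 2` lies between them, `odot a a` already vanishes at `p` only. -/
theorem exists_zero_pos_of_lt {p q : A → LukChain n} (hp : IsMVHom p) (hq : IsMVHom q) (m : ℕ) :
    ∀ a : A, (p a).1 + (1 / 2) ^ m ≤ (q a).1 →
      ∃ c, ((p c).1 = 0 ∧ 0 < (q c).1) ∨ ((q c).1 = 0 ∧ 0 < (p c).1) := by
  induction m with
  | zero =>
    intro a ha
    have h1 := LukChain.val_nonneg (p a)
    have h2 := LukChain.val_le_one (q a)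
    exact ⟨a, .inl ⟨by linarith, by linarith⟩⟩
  | succ m ih =>
    intro a ha
    have hpos : (0 : ℚ) < (1 / 2) ^ m := by positivity
    rw [pow_succ] at ha
    have h1 := hp.val_add a a
    have h2 := hq.val_add a a
    have h3 := hp.map_odot a a
    have h4 := hq.map_odot a a
    have h5 := hp.val_compl (a + a)
    have h6 := hq.val_compl (a + a)
    rcases le_or_gt (q a).1 (1 / 2) with h | h
    · refine ih (a + a) ?_
      rw [h1, h2, min_eq_right (by linarith), min_eq_right (by linarith)]
      linarith
    rcases le_or_gt (p a).1 (1 / 2) with h' | h'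
    · refine ⟨odot a a, .inl ⟨?_, ?_⟩⟩
      · rw [h3, max_eq_left (by linarith)]
      · rw [h4]; exact lt_max_of_lt_right (by linarith)
    · refine ih (odot a a) ?_
      rw [h3, h4, max_eq_right (by linarith), max_eq_right (by linarith)]
      linarith

/-- An element all of whose values are `0` or `1`. -/
def IsBool (n : ℕ) [NeZero n] (b : A) : Prop :=
  ∀ p : A → LukChain n, IsMVHom p → p b = 0 ∨ p b = 0ᶜ

theorem isBool_nsmul (c : A) : IsBool n (n • c) := fun p hp => by
  rw [hp.map_nsmul]
  by_cases h : p c = 0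
  · left; rw [h, nsmul_zero]
  · right; exact LukChain.nsmul_eq_one h

theorem IsBool.compl {b : A} (hb : IsBool n b) : IsBool n bᶜ := fun p hp => by
  rw [hp.map_compl]
  rcases hb p hp with h | h
  · right; rw [h]
  · left; rw [h, one_compl]

theorem IsBool.add {b c : A} (hb : IsBool n b) (hc : IsBool n c) : IsBool n (b + c) :=
  fun p hp => by
  rw [hp.map_add]
  rcases hb p hp with h | h
  · rw [h, zero_add]; exact hc p hp
  · right; rw [h, LukChain.one_add]

theorem isBool_zero : IsBool n (0 : A) := fun _ hp => .inl hp.map_zero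

/-- Distinct homomorphisms to the chain are separated by Boolean elements. -/
theorem exists_isBool_separating {p q : A → LukChain n} (hp : IsMVHom p) (hq : IsMVHom q)
    (hpq : p ≠ q) : ∃ b, IsBool n b ∧ p b = 0 ∧ q b = 0ᶜ := by
  have key : ∃ c, ((p c).1 = 0 ∧ 0 < (q c).1) ∨ ((q c).1 = 0 ∧ 0 < (p c).1) := by
    obtain ⟨a, ha⟩ := Function.ne_iff.1 hpq
    have ha' : (p a).1 ≠ (q a).1 := fun h => ha (Subtype.ext h)
    rcases lt_or_gt_of_ne ha' with h | h
    · obtain ⟨m, hm⟩ := exists_pow_lt_of_lt_one (sub_pos.2 h) (by norm_num : (1 / 2 : ℚ) < 1)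
      exact exists_zero_pos_of_lt hp hq m a (by linarith)
    · obtain ⟨m, hm⟩ := exists_pow_lt_of_lt_one (sub_pos.2 h) (by norm_num : (1 / 2 : ℚ) < 1)
      obtain ⟨c, hc⟩ := exists_zero_pos_of_lt hq hp m a (by linarith)
      exact ⟨c, hc.symm⟩
  have ne_zero : ∀ x : LukChain n, 0 < x.1 → x ≠ 0 := fun x hx h => by
    rw [h, LukChain.val_zero] at hx
    exact lt_irrefl _ hx
  obtain ⟨c, ⟨h0, h1⟩ | ⟨h0, h1⟩⟩ := key
  · refine ⟨n • c, isBool_nsmul c, ?_, ?_⟩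
    · rw [hp.map_nsmul, show p c = 0 from Subtype.ext h0, nsmul_zero]
    · rw [hq.map_nsmul, LukChain.nsmul_eq_one (ne_zero _ h1)]
  · refine ⟨(n • c)ᶜ, (isBool_nsmul c).compl, ?_, ?_⟩
    · rw [hp.map_compl, hp.map_nsmul, LukChain.nsmul_eq_one (ne_zero _ h1), one_compl]
    · rw [hq.map_compl, hq.map_nsmul, show q c = 0 from Subtype.ext h0, nsmul_zero]

end Separation

end MVStone

namespace MVStone

/-! ### The spectrum and gluing of local representatives -/

section Spectrum

variable {A : Type u} [MVAlgebra A] {n : ℕ} [NeZero n]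

/-- The homomorphisms from an MV-algebra to the chain. -/
def Point (n : ℕ) [NeZero n] (A : Type u) [MVAlgebra A] : Type u :=
  {p : A → LukChain n // IsMVHom p}

instance : TopologicalSpace (Point n A) := instTopologicalSpaceSubtype

instance : T2Space (Point n A) := inferInstanceAs (T2Space {p : A → LukChain n // IsMVHom p})

instance : TotallyDisconnectedSpace (Point n A) :=
  inferInstanceAs (TotallyDisconnectedSpace {p : A → LukChain n // IsMVHom p})

theorem continuous_point_apply (a : A) : Continuous fun p : Point n A => p.1 a :=
  (continuous_apply a).comp continuous_subtype_val

theorem isClosed_setOf_isMVHom : IsClosed {p : A → LukChain n | IsMVHom p} := by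
  have : {p : A → LukChain n | IsMVHom p} = {p | p 0 = 0} ∩ ((⋂ x, {p | p xᶜ = (p x)ᶜ}) ∩
      ⋂ x, ⋂ y, {p | p (x + y) = p x + p y}) := by
    ext p
    simp only [Set.mem_inter_iff, Set.mem_iInter]
    exact ⟨fun h => ⟨h.1, h.2, h.3⟩, fun h => ⟨h.1, h.2.1, h.2.2⟩⟩
  rw [this]
  refine .inter ?_ (.inter (isClosed_iInter fun x => ?_)
    (isClosed_iInter fun x => isClosed_iInter fun y => ?_))
  · exact isClosed_eq (by fun_prop) (by fun_prop)
  · exact isClosed_eq (by fun_prop) (continuous_of_discreteTopology.comp (continuous_apply x))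
  · exact isClosed_eq (by fun_prop)
      ((continuous_of_discreteTopology (f := fun z : LukChain n × LukChain n => z.1 + z.2)).comp
        (Continuous.prodMk (continuous_apply x) (continuous_apply y)))

instance : CompactSpace (Point n A) :=
  isCompact_iff_compactSpace.1 isClosed_setOf_isMVHom.isCompact

/-- Each point of `S` has a neighbourhood on which some separating Boolean element is `1`; a finite
sum of these covers `S` and still vanishes at `x`. -/
theorem exists_isBool_zero_on (x : Point n A) {S : Set (Point n A)} (hS : IsCompact S)
    (hx : x ∉ S) : ∃ b : A, IsBool n b ∧ x.1 b = 0 ∧ ∀ y ∈ S, y.1 b = 0ᶜ := by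
  refine hS.induction_on (p := fun S => ∃ b : A, IsBool n b ∧ x.1 b = 0 ∧ ∀ y ∈ S, y.1 b = 0ᶜ)
    ⟨0, isBool_zero, x.2.map_zero, by simp⟩ ?_ ?_ ?_
  · rintro s t hst ⟨b, h1, h2, h3⟩
    exact ⟨b, h1, h2, fun y hy => h3 y (hst hy)⟩
  · rintro s t ⟨b, h1, h2, h3⟩ ⟨c, h4, h5, h6⟩
    refine ⟨b + c, h1.add h4, by rw [x.2.map_add, h2, h5, zero_add], ?_⟩
    rintro y (hy | hy)
    · rw [y.2.map_add, h3 y hy, LukChain.one_add]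
    · rw [y.2.map_add, h6 y hy, MVAlgebra.add_one']
  · intro y hy
    have hne : x.1 ≠ y.1 := fun h => hx (by rwa [Subtype.ext h])
    obtain ⟨b, h1, h2, h3⟩ := exists_isBool_separating x.2 y.2 hne
    refine ⟨{z | z.1 b = 0ᶜ}, mem_nhdsWithin_of_mem_nhds ?_, b, h1, h2, fun z hz => hz⟩
    exact ((isOpen_discrete {0ᶜ}).preimage (continuous_point_apply b)).mem_nhds h3

/-- The element equal to `a` where the Boolean element `e` is `1`, and to `b` where it is `0`. -/
def glue (e a b : A) : A := odot e a + odot eᶜ b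

theorem glue_of_one {p : A → LukChain n} (hp : IsMVHom p) {e : A} (a b : A) (he : p e = 0ᶜ) :
    p (glue e a b) = p a := by
  have hv : (p e).1 = 1 := by rw [he, LukChain.val_compl, LukChain.val_zero, sub_zero]
  refine Subtype.ext ?_
  rw [glue, hp.val_add, hp.map_odot, hp.map_odot, hp.val_compl, hv]
  have h1 := LukChain.val_nonneg (p a)
  have h2 := LukChain.val_le_one (p a)
  have h3 := LukChain.val_le_one (p b)
  grind

theorem glue_of_zero {p : A → LukChain n} (hp : IsMVHom p) {e : A} (a b : A) (he : p e = 0) :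
    p (glue e a b) = p b := by
  have hv : (p e).1 = 0 := by rw [he, LukChain.val_zero]
  refine Subtype.ext ?_
  rw [glue, hp.val_add, hp.map_odot, hp.map_odot, hp.val_compl, hv]
  have h1 := LukChain.val_nonneg (p b)
  have h2 := LukChain.val_le_one (p a)
  have h3 := LukChain.val_le_one (p b)
  grind

/-- A continuous function on the spectrum whose values are pointwise values of elements of the
algebra is given by an element of the algebra. -/
theorem exists_eq_apply (g : Point n A → LukChain n) (hg : Continuous g)
    (hval : ∀ x : Point n A, ∃ a, x.1 a = g x) :
    ∃ a : A, ∀ x : Point n A, x.1 a = g x := by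
  -- Correctness of `a` is required wherever `e` is `1`, not only on the covered set, so that `glue
  -- e a b` is correct wherever `e + f` is `1`.
  have key : ∃ (a e : A), IsBool n e ∧ (∀ x ∈ (Set.univ : Set (Point n A)), x.1 e = 0ᶜ) ∧
      ∀ x : Point n A, x.1 e = 0ᶜ → x.1 a = g x := by
    refine isCompact_univ.induction_on (p := fun S : Set (Point n A) =>
      ∃ a e : A, IsBool n e ∧ (∀ x ∈ S, x.1 e = 0ᶜ) ∧ ∀ x : Point n A, x.1 e = 0ᶜ → x.1 a = g x)
      ⟨0, 0, isBool_zero, by simp, fun x hx => ?_⟩ ?_ ?_ ?_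
    · exact absurd (hx.symm.trans x.2.map_zero) LukChain.one_ne_zero
    · rintro s t hst ⟨a, e, h1, h2, h3⟩
      exact ⟨a, e, h1, fun x hx => h2 x (hst hx), h3⟩
    · rintro s t ⟨a, e, h1, h2, h3⟩ ⟨b, f, h4, h5, h6⟩
      refine ⟨glue e a b, e + f, h1.add h4, ?_, fun x hx => ?_⟩
      · rintro x (hx | hx)
        · rw [x.2.map_add, h2 x hx, LukChain.one_add]
        · rw [x.2.map_add, h5 x hx, MVAlgebra.add_one']
      · rcases h1 x.1 x.2 with h | h
        · rw [glue_of_zero x.2 a b h]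
          rw [x.2.map_add, h, zero_add] at hx
          exact h6 x hx
        · rw [glue_of_one x.2 a b h]
          exact h3 x h
    · intro x _
      obtain ⟨a, ha⟩ := hval x
      have hcl : IsClosed {y : Point n A | y.1 a ≠ g y} :=
        (isClosed_discrete {z : LukChain n × LukChain n | z.1 ≠ z.2}).preimage
          ((continuous_point_apply a).prodMk hg)
      obtain ⟨b, h1, h2, h3⟩ := exists_isBool_zero_on x hcl.isCompact (fun h => h ha)
      refine ⟨{z | z.1 b = 0}, mem_nhdsWithin_of_mem_nhds ?_, a, bᶜ, h1.compl, fun z hz => ?_,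
        fun z hz => ?_⟩
      · exact ((isOpen_discrete {0}).preimage (continuous_point_apply b)).mem_nhds h2
      · rw [z.2.map_compl, show z.1 b = 0 from hz]
      · by_contra hne
        rw [z.2.map_compl, h3 z hne, one_compl] at hz
        exact LukChain.one_ne_zero hz.symm
  obtain ⟨a, e, -, h2, h3⟩ := key
  exact ⟨a, fun x => h3 x (h2 x trivial)⟩

/-- The spectrum of an MV-algebra; the `i`-th open set consists of the homomorphisms that take
the value `i / n`. -/
def specTop (n : ℕ) [NeZero n] (A : Type u) [MVAlgebra A] : TopN.{u} n where
  carrier := Point n A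
  o i := {p | ∃ a, (p.1 a).1 = (i : ℕ) / n}
  isOpen_o i := by
    have : {p : Point n A | ∃ a, (p.1 a).1 = ((i : ℕ) : ℚ) / n} =
        ⋃ a : A, {p : Point n A | (p.1 a).1 = ((i : ℕ) : ℚ) / n} := by
      ext p; simp
    rw [this]
    exact isOpen_iUnion fun a => (isOpen_discrete
      {c : LukChain n | c.1 = ((i : ℕ) : ℚ) / n}).preimage (continuous_point_apply a)
  symm_o := by
    have key : ∀ i j : Idx n, (i : ℕ) + j = n →
        {p : Point n A | ∃ a, (p.1 a).1 = ((i : ℕ) : ℚ) / n} ⊆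
        {p : Point n A | ∃ a, (p.1 a).1 = ((j : ℕ) : ℚ) / n} := by
      rintro i j hij p ⟨a, ha⟩
      have hn := LukChain.cast_pos (n := n)
      have hij' : ((i : ℕ) : ℚ) + (j : ℕ) = n := by exact_mod_cast hij
      refine ⟨aᶜ, ?_⟩
      rw [p.2.val_compl, ha, eq_div_iff hn.ne', sub_mul, div_mul_cancel₀ _ hn.ne']
      linarith
    exact fun i j hij => (key i j hij).antisymm (key j i (by omega))
  inter_o := by
    rintro h k i hi p ⟨⟨a, ha⟩, ⟨b, hb⟩⟩
    have hn := LukChain.cast_pos (n := n)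
    refine ⟨a + b, ?_⟩
    rw [p.2.val_add, ha, hb, ← add_div, ← hi, Nat.cast_add]
    -- Since `h + k = i < n`, the sum is not truncated.
    refine min_eq_right (div_le_one_of_le₀ ?_ hn.le)
    have := i.2
    exact_mod_cast (by omega : (h : ℕ) + k ≤ n)

end Spectrum

/-! ### The dual algebra of functions and its homomorphisms -/

section Functions

variable {n : ℕ}

/-- The values that elements of the dual algebra may take at a point. -/
def TopN.Allowed (X : TopN.{u} n) (x : X.carrier) (c : LukChain n) : Prop :=
  ∀ i : Idx n, c.1 = ((i : ℕ) : ℚ) / n → x ∈ X.o i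

/-- The dual algebra: continuous functions to the chain with allowed values. -/
def Fun (X : TopN.{u} n) : Type u :=
  {f : X.carrier → LukChain n // Continuous f ∧ ∀ x, X.Allowed x (f x)}

variable {X Y : TopN.{u} n}

@[ext]
theorem Fun.ext {f g : Fun X} (h : ∀ x, f.1 x = g.1 x) : f = g := Subtype.ext (funext h)

theorem TopN.Hom.allowed (f : TopN.Hom X Y) {x : X.carrier} {c : LukChain n}
    (hc : Y.Allowed (f.map x) c) : X.Allowed x c :=
  fun i hi => f.preimage_subset i (hc i hi)

variable [NeZero n]

theorem div_inj {i j : ℕ} (h : (i : ℚ) / n = (j : ℚ) / n) : i = j := by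
  have hn := LukChain.cast_pos (n := n)
  exact_mod_cast (div_left_inj' hn.ne').1 h

theorem TopN.allowed_zero (X : TopN.{u} n) (x : X.carrier) : X.Allowed x 0 := by
  intro i hi
  have h : ((0 : ℕ) : ℚ) / n = ((i : ℕ) : ℚ) / n := by rw [← hi, LukChain.val_zero]; simp
  have := div_inj h
  have := i.2
  omega

theorem TopN.Allowed.compl {X : TopN.{u} n} {x : X.carrier} {c : LukChain n}
    (hc : X.Allowed x c) : X.Allowed x cᶜ := by
  intro i hi
  have hn := LukChain.cast_pos (n := n)
  have h2 := i.2
  have h1 : c.1 = ((n - i : ℕ) : ℚ) / n := by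
    rw [LukChain.val_compl] at hi
    rw [Nat.cast_sub (by omega), sub_div, div_self hn.ne', ← hi]
    ring
  have := hc ⟨n - i, by omega⟩ h1
  rwa [X.symm_o ⟨n - i, by omega⟩ i (Nat.sub_add_cancel (by omega))] at this

theorem TopN.allowed_one (X : TopN.{u} n) (x : X.carrier) : X.Allowed x 0ᶜ :=
  (X.allowed_zero x).compl

/-- Only a sum below `1` imposes a condition; it is then untruncated, so the numerators add up to
`i`. -/
theorem TopN.Allowed.add {X : TopN.{u} n} {x : X.carrier} {c d : LukChain n}
    (hc : X.Allowed x c) (hd : X.Allowed x d) : X.Allowed x (c + d) := by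
  intro i hi
  have hn := LukChain.cast_pos (n := n)
  have h2 := i.2
  obtain ⟨j, hj, hjc⟩ := c.2
  obtain ⟨k, hk, hkd⟩ := d.2
  rw [LukChain.val_add, hjc, hkd, ← add_div] at hi
  have hlt : ((i : ℕ) : ℚ) / n < 1 := by
    rw [div_lt_one hn]; exact_mod_cast (by omega : (i : ℕ) < n)
  have hjk : ((j + k : ℕ) : ℚ) / n = ((i : ℕ) : ℚ) / n := by
    rw [Nat.cast_add, ← hi, min_eq_right]
    by_contra! h
    rw [min_eq_left h.le] at hi
    exact hlt.ne hi.symm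
  have hjk' := div_inj hjk
  -- `inter_o` covers positive indices only; a zero summand leaves the other value unchanged.
  rcases Nat.eq_zero_or_pos j with rfl | hj0
  · exact hd i (by rw [hkd]; congr 2; omega)
  rcases Nat.eq_zero_or_pos k with rfl | hk0
  · exact hc i (by rw [hjc]; congr 2)
  exact X.inter_o ⟨j, by omega⟩ ⟨k, by omega⟩ i hjk' ⟨hc _ hjc, hd _ hkd⟩

instance : Zero (Fun X) := ⟨⟨fun _ => 0, continuous_const, X.allowed_zero⟩⟩

instance : Add (Fun X) := ⟨fun f g => ⟨fun x => f.1 x + g.1 x,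
  (continuous_of_discreteTopology (f := fun z : LukChain n × LukChain n => z.1 + z.2)).comp
    (f.2.1.prodMk g.2.1), fun x => (f.2.2 x).add (g.2.2 x)⟩⟩

instance : Compl (Fun X) := ⟨fun f => ⟨fun x => (f.1 x)ᶜ,
  (continuous_of_discreteTopology (f := fun z : LukChain n => zᶜ)).comp f.2.1,
    fun x => (f.2.2 x).compl⟩⟩

instance : MVAlgebra (Fun X) where
  add_assoc _ _ _ := Fun.ext fun _ => add_assoc _ _ _
  zero_add _ := Fun.ext fun _ => zero_add _
  add_zero _ := Fun.ext fun _ => add_zero _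
  add_comm _ _ := Fun.ext fun _ => add_comm _ _
  nsmul := nsmulRec
  compl_compl' _ := Fun.ext fun _ => MVAlgebra.compl_compl' _
  add_one' _ := Fun.ext fun _ => MVAlgebra.add_one' _
  luk' _ _ := Fun.ext fun _ => MVAlgebra.luk' _ _

theorem isMVHom_apply (x : X.carrier) : IsMVHom fun f : Fun X => f.1 x :=
  ⟨rfl, fun _ => rfl, fun _ _ => rfl⟩

theorem inVariety_fun : InVariety n (Fun X) :=
  inVariety_of_separated fun _ _ h => Fun.ext fun x => h _ (isMVHom_apply x)

open Classical in
/-- The function with value `c` on a clopen set and `0` elsewhere. -/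
noncomputable def bump (U : Set X.carrier) (hU : IsClopen U) (c : LukChain n)
    (hc : ∀ x ∈ U, X.Allowed x c) : Fun X :=
  ⟨fun x => if x ∈ U then c else 0, by
    refine continuous_const.if (fun x hx => ?_) continuous_const
    rw [show {a | a ∈ U} = U from rfl, hU.frontier_eq] at hx
    exact hx.elim, fun x => by
    dsimp only
    split_ifs with h
    · exact hc x h
    · exact X.allowed_zero x⟩

theorem bump_of_mem {U : Set X.carrier} (hU : IsClopen U) {c : LukChain n}
    (hc : ∀ x ∈ U, X.Allowed x c) {x : X.carrier} (hx : x ∈ U) : (bump U hU c hc).1 x = c :=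
  if_pos hx

theorem bump_of_notMem {U : Set X.carrier} (hU : IsClopen U) {c : LukChain n}
    (hc : ∀ x ∈ U, X.Allowed x c) {x : X.carrier} (hx : x ∉ U) : (bump U hU c hc).1 x = 0 :=
  if_neg hx

/-- The indicator function of a clopen set. -/
noncomputable def indicator (U : Set X.carrier) (hU : IsClopen U) : Fun X :=
  bump U hU 0ᶜ fun x _ => X.allowed_one x

theorem indicator_eq_one {U : Set X.carrier} (hU : IsClopen U) {x : X.carrier} :
    (indicator U hU).1 x = 0ᶜ ↔ x ∈ U := by
  refine ⟨fun h => ?_, fun h => bump_of_mem hU _ h⟩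
  by_contra hx
  exact LukChain.one_ne_zero (h.symm.trans (bump_of_notMem hU _ hx))

section Stone

variable [CompactSpace X.carrier] [T2Space X.carrier] [TotallyDisconnectedSpace X.carrier]

/-- A clopen neighbourhood of `x` inside the open set `o i` carries the constant `i / n`. Thus the
algebra determines the sets `o i`. -/
theorem exists_apply_eq {x : X.carrier} {i : Idx n} (hx : x ∈ X.o i) :
    ∃ f : Fun X, (f.1 x).1 = ((i : ℕ) : ℚ) / n := by
  obtain ⟨V, hV, hxV, hVU⟩ := compact_exists_isClopen_in_isOpen (X.isOpen_o i) hx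
  have h2 := i.2
  obtain ⟨c, hc⟩ : ∃ c : LukChain n, c.1 = ((i : ℕ) : ℚ) / n := ⟨⟨_, i, by omega, rfl⟩, rfl⟩
  refine ⟨bump V hV c fun y hy j hj => ?_, ?_⟩
  · rw [show j = i from Subtype.ext (div_inj (hj.symm.trans hc))]
    exact hVU hy
  · exact (congrArg Subtype.val (bump_of_mem hV _ hxV)).trans hc

theorem eq_of_apply_eq {x y : X.carrier} (h : ∀ f : Fun X, f.1 x = f.1 y) : x = y := by
  by_contra hne
  obtain ⟨V, hV, hxV, hVy⟩ := compact_exists_isClopen_in_isOpen isOpen_compl_singleton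
    (show x ∈ ({y}ᶜ : Set X.carrier) from hne)
  have := (indicator_eq_one hV).1 ((h _).symm.trans ((indicator_eq_one hV).2 hxV))
  exact hVy this rfl

end Stone

/-- Every homomorphism from the dual algebra to the chain is an evaluation. -/
theorem exists_eq_eval [CompactSpace X.carrier] {p : Fun X → LukChain n} (hp : IsMVHom p) :
    ∃ x, ∀ f, p f = f.1 x := by
  by_contra! hcon
  -- If `p` differs from every evaluation, finitely many separating elements sum to the constant
  -- `1`, which `p` would send to `0`.
  have key : ∃ b : Fun X, p b = 0 ∧ ∀ y ∈ (Set.univ : Set X.carrier), b.1 y = 0ᶜ := by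
    refine isCompact_univ.induction_on
      (p := fun S => ∃ b : Fun X, p b = 0 ∧ ∀ y ∈ S, b.1 y = 0ᶜ)
      ⟨0, hp.map_zero, by simp⟩ ?_ ?_ ?_
    · rintro s t hst ⟨b, h2, h3⟩
      exact ⟨b, h2, fun y hy => h3 y (hst hy)⟩
    · rintro s t ⟨b, h2, h3⟩ ⟨c, h5, h6⟩
      refine ⟨b + c, by rw [hp.map_add, h2, h5, zero_add], ?_⟩
      rintro y (hy | hy)
      · change b.1 y + c.1 y = _
        rw [h3 y hy, LukChain.one_add]
      · change b.1 y + c.1 y = _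
        rw [h6 y hy, MVAlgebra.add_one']
    · intro y _
      obtain ⟨f, hf⟩ := hcon y
      obtain ⟨b, -, h2, h3⟩ :=
        exists_isBool_separating hp (isMVHom_apply y) (fun h => hf (congrFun h f))
      exact ⟨{z | b.1 z = 0ᶜ}, mem_nhdsWithin_of_mem_nhds
        (((isOpen_discrete {0ᶜ}).preimage b.2.1).mem_nhds h3), b, h2, fun z hz => hz⟩
  obtain ⟨b, h1, h2⟩ := key
  have : b = 0ᶜ := Fun.ext fun x => h2 x trivial
  rw [this, hp.map_compl, hp.map_zero] at h1
  exact LukChain.one_ne_zero h1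

/-- Composition with a morphism. -/
def pullback (f : TopN.Hom X Y) : MVHom (Fun Y) (Fun X) where
  toFun g := ⟨fun x => g.1 (f.map x), g.2.1.comp f.map.continuous,
    fun x => f.allowed (g.2.2 (f.map x))⟩
  map_zero' := rfl
  map_add' _ _ := rfl
  map_compl' _ := rfl

theorem MVHom.isMVHom_comp {A B : Type u} [MVAlgebra A] [MVAlgebra B] (φ : MVHom A B)
    {p : B → LukChain n} (hp : IsMVHom p) : IsMVHom fun a => p (φ.toFun a) where
  map_zero := by rw [φ.map_zero', hp.map_zero]
  map_compl a := by rw [φ.map_compl', hp.map_compl]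
  map_add a b := by rw [φ.map_add', hp.map_add]

/-- Every homomorphism between dual algebras is composition with a morphism. -/
theorem pullback_surjective [CompactSpace Y.carrier] [T2Space Y.carrier]
    [TotallyDisconnectedSpace Y.carrier] (φ : MVHom (Fun Y) (Fun X)) :
    ∃ f : TopN.Hom X Y, pullback f = φ := by
  choose f hf using fun x => exists_eq_eval (φ.isMVHom_comp (isMVHom_apply x))
  have hcont : Continuous f := by
    refine isTopologicalBasis_isClopen.continuous_iff.2 fun U hU => ?_
    have : f ⁻¹' U = (φ.toFun (indicator U hU)).1 ⁻¹' {0ᶜ} := by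
      ext x
      rw [Set.mem_preimage, Set.mem_preimage, Set.mem_singleton_iff, hf, indicator_eq_one]
    rw [this]
    exact (isOpen_discrete _).preimage (φ.toFun (indicator U hU)).2.1
  refine ⟨⟨⟨f, hcont⟩, fun i x hx => ?_⟩, ?_⟩
  -- The value `i / n` of `g` at `f x` is also the value of `φ g` at `x`, so it is allowed there.
  · obtain ⟨g, hg⟩ := exists_apply_eq (show f x ∈ Y.o i from hx)
    rw [← hf] at hg
    exact (φ.toFun g).2.2 x i hg
  · refine MVHom.ext (funext fun g => Fun.ext fun x => ?_)
    exact (hf x g).symm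

theorem pullback_injective [CompactSpace Y.carrier] [T2Space Y.carrier]
    [TotallyDisconnectedSpace Y.carrier] {f g : TopN.Hom X Y} (h : pullback f = pullback g) :
    f = g := by
  refine TopN.Hom.ext (ContinuousMap.ext fun x => eq_of_apply_eq fun k => ?_)
  exact congrArg (fun φ : MVHom (Fun Y) (Fun X) => (φ.toFun k).1 x) h

/-- The evaluation homomorphism to the dual algebra of the spectrum. -/
def evalHom (n : ℕ) [NeZero n] (A : Type u) [MVAlgebra A] : MVHom A (Fun (specTop n A)) where
  toFun a := ⟨fun p => p.1 a, continuous_point_apply a, fun _ _ hi => ⟨a, hi⟩⟩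
  map_zero' := Fun.ext fun p => p.2.map_zero
  map_add' a b := Fun.ext fun p => p.2.map_add a b
  map_compl' a := Fun.ext fun p => p.2.map_compl a

theorem evalHom_bijective {A : Type u} [MVAlgebra A] (hA : InVariety n A) :
    Function.Bijective (evalHom n A).toFun := by
  constructor
  · intro a b hab
    by_contra hne
    obtain ⟨p, hp, hpab⟩ := hA.exists_isMVHom hne
    exact hpab (congrArg (fun g : Fun (specTop n A) => g.1 ⟨p, hp⟩) hab)
  · intro g
    -- Allowed values are attained: `0` and `1` by constants, the others by the definition of the
    -- open sets of the spectrum.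
    obtain ⟨a, ha⟩ := exists_eq_apply (A := A) g.1 g.2.1 fun x => by
      obtain ⟨j, hj, hjg⟩ := (g.1 x).2
      rcases Nat.eq_zero_or_pos j with rfl | hj0
      · refine ⟨0, x.2.map_zero.trans (Subtype.ext ?_)⟩
        rw [hjg, LukChain.val_zero, Nat.cast_zero, zero_div]
      rcases eq_or_lt_of_le hj with rfl | hjn
      · refine ⟨0ᶜ, Subtype.ext ?_⟩
        rw [hjg, x.2.val_compl, x.2.map_zero, LukChain.val_zero, sub_zero,
          div_self LukChain.cast_pos.ne']
      · obtain ⟨a, ha⟩ := g.2.2 x ⟨j, by omega⟩ hjg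
        exact ⟨a, Subtype.ext (ha.trans hjg.symm)⟩
    exact ⟨a, Fun.ext ha⟩

end Functions

/-! ### The equivalence of categories -/

section Categories

/-- The inverse of a bijective homomorphism. -/
noncomputable def MVHom.inverse {A B : Type u} [MVAlgebra A] [MVAlgebra B] (φ : MVHom A B)
    (hφ : Function.Bijective φ.toFun) : MVHom B A where
  toFun := (Equiv.ofBijective _ hφ).symm
  map_zero' := (Equiv.symm_apply_eq _).2 φ.map_zero'.symm
  map_add' x y := (Equiv.symm_apply_eq _).2 <| by
    refine Eq.trans ?_ (φ.map_add' _ _).symm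
    exact congrArg₂ _ ((Equiv.ofBijective _ hφ).apply_symm_apply x).symm
      ((Equiv.ofBijective _ hφ).apply_symm_apply y).symm
  map_compl' x := (Equiv.symm_apply_eq _).2 <| by
    refine Eq.trans ?_ (φ.map_compl' _).symm
    exact congrArg _ ((Equiv.ofBijective _ hφ).apply_symm_apply x).symm

/-- A bijective homomorphism is an isomorphism. -/
noncomputable def isoOfBijective {A B : MVAlg.{u}} (φ : MVHom A.carrier B.carrier)
    (hφ : Function.Bijective φ.toFun) : A ≅ B where
  hom := φ
  inv := φ.inverse hφ
  hom_inv_id := MVHom.ext (funext fun x => (Equiv.ofBijective _ hφ).symm_apply_apply x)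
  inv_hom_id := MVHom.ext (funext fun x => (Equiv.ofBijective _ hφ).apply_symm_apply x)

variable (n : ℕ) [NeZero n]

/-- The functor that sends a Stone space with distinguished open sets to its dual algebra. -/
def dual : StoneN.{u} n ⥤ (MVn.{u} n)ᵒᵖ where
  obj X := .op ⟨⟨Fun X.obj⟩, inVariety_fun⟩
  map f := .op (ObjectProperty.homMk (pullback f.hom))

instance : (dual.{u} n).Faithful where
  map_injective {X Y f g} h := by
    have := Y.property.1
    have := Y.property.2.1
    have := Y.property.2.2
    exact ObjectProperty.hom_ext _
      (pullback_injective (congrArg (fun k => k.unop.hom) h))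

instance : (dual.{u} n).Full where
  map_surjective {X Y} φ := by
    have := Y.property.1
    have := Y.property.2.1
    have := Y.property.2.2
    obtain ⟨f, hf⟩ := pullback_surjective φ.unop.hom
    exact ⟨ObjectProperty.homMk f, Quiver.Hom.unop_inj (ObjectProperty.hom_ext _ hf)⟩

instance : (dual.{u} n).EssSurj where
  mem_essImage A := by
    refine ⟨⟨specTop n A.unop.obj.carrier, inferInstanceAs (CompactSpace (Point n _)),
      inferInstanceAs (T2Space (Point n _)),
      inferInstanceAs (TotallyDisconnectedSpace (Point n _))⟩, ⟨Iso.op ?_⟩⟩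
    exact ObjectProperty.isoMk _
      (isoOfBijective (evalHom n A.unop.obj.carrier) (evalHom_bijective A.unop.property))

instance : (dual.{u} n).IsEquivalence where

end Categories

end MVStone

theorem corollary6p5 (n : ℕ) [NeZero n] :
    Nonempty ((MVStone.MVn.{u} n)ᵒᵖ ≌ MVStone.StoneN.{u} n) := by
  exact ⟨(MVStone.dual n).asEquivalence.symm⟩
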